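/- Let $(M,g)$ be a smooth finite-dimensional Riemannian manifold (without boundary). For smooth functions $\phi,\psi:M\to\mathbb C$, let $\tau$ be the Laplace–Beltrami operator (tension field) and $\kappa$ the complex bilinear conformality operator, given in local coordinates by $$\tau(\phi)=\operatorname{div}(\nabla\phi)=\sum_{i,j}\frac1{\sqrt{|g|}}\frac{\partial}{\partial x_j}\Bigl(g^{ij}\sqrt{|g|}\,\frac{\partial\phi}{\partial x_i}\Bigr),\qquad \kappa(\phi,\psi)=g(\nabla\phi,\nabla\psi)=\sum_{i,j}g^{ij}\frac{\partial\phi}{\partial x_i}\frac{\partial\psi}{\partial x_j},$$ where $|g|=\det(g_{ij})$ and $g$ is extended complex bilinearly. For $\lambda,\mu\in\mathbb C$, a set $\mathcal E$ of smooth functions $M\to\mathbb C$ is called a $(\lambda,\mu)$-eigenfamily on $M$ if $\tau(\phi)=\lambda\,\phi$ and $\kappa(\phi,\psi)=\mu\,\phi\,\psi$ for all $\phi,\psi\in\mathcal E$. **Theorem.** Let $(M_1,g_1)$ and $(M_2,g_2)$ be Riemannian manifolds and let $N=M_1\times M_2$ be their Riemannian product, with the product metric $g=\pi_1^*g_1+\pi_2^*g_2$,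 where $\pi_k:N\to M_k$ are the projections. Suppose that $\mathcal E_1$ is a $(\lambda_1,\mu_1)$-eigenfamily on $M_1$ and $\mathcal E_2$ is a $(\lambda_2,\mu_2)$-eigenfamily on $M_2$. Then the set $$\mathcal E=\{\phi:N\to\mathbb C\ |\ \phi(p_1,p_2)=\phi_1(p_1)\,\phi_2(p_2)\text{ for some }\phi_1\in\mathcal E_1,\ \phi_2\in\mathcal E_2\}$$ is a $(\lambda_1+\lambda_2,\ \mu_1+\mu_2)$-eigenfamily on $N$: every $\phi\in\mathcal E$ is smooth, and the operators $\tau,\kappa$ of $(N,g)$ satisfy $\tau(\phi)=(\lambda_1+\lambda_2)\,\phi$ and $\kappa(\phi,\psi)=(\mu_1+\mu_2)\,\phi\,\psi$ for all $\phi,\psi\in\mathcal E$. -/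

import Mathlib

open scoped Manifold ContDiff Topology Bundle

noncomputable section

namespace EigenFamily

/-- A smooth Riemannian metric on the smooth manifold `M`. -/
abbrev SmoothMetric {E : Type*} [NormedAddCommGroup E] [NormedSpace ℝ E]
    {H : Type*} [TopologicalSpace H] (I : ModelWithCorners ℝ E H)
    (M : Type*) [TopologicalSpace M] [ChartedSpace H M] [IsManifold I ∞ M] : Type _ :=
  Bundle.ContMDiffRiemannianMetric I ∞ E (TangentSpace I : M → Type _)

section Pullback

variable {E : Type*} [NormedAddCommGroup E] [NormedSpace ℝ E]
  {H : Type*} [TopologicalSpace H] {I : ModelWithCorners ℝ E H}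
  {M : Type*} [TopologicalSpace M] [ChartedSpace H M] [IsManifold I ∞ M]
  {E' : Type*} [NormedAddCommGroup E'] [NormedSpace ℝ E']
  {H' : Type*} [TopologicalSpace H'] {I' : ModelWithCorners ℝ E' H'}
  {N : Type*} [TopologicalSpace N] [ChartedSpace H' N]

/-- The pullback `f^* g` of the metric `g` by `f : N → M`, a field of bilinear forms on `N`:
`(f^* g)_x (v, w) = g_{f x} (df_x v, df_x w)`. -/
def pullback (g : SmoothMetric I M) (f : N → M) (x : N) :
    TangentSpace I' x →L[ℝ] TangentSpace I' x →L[ℝ] ℝ :=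
  (ContinuousLinearMap.precomp ℝ (mfderiv I' I f x)) ∘L (g.inner (f x)) ∘L (mfderiv I' I f x)

lemma inner_self_nonneg (g : SmoothMetric I M) (x : M) (v : TangentSpace I x) :
    0 ≤ g.inner x v v := by
  rcases eq_or_ne v 0 with rfl | h
  · simp
  · exact (g.pos x v h).le

lemma pullback_apply (g : SmoothMetric I M) (f : N → M) (x : N) (v w : TangentSpace I' x) :
    pullback g f x v w = g.inner (f x) (mfderiv I' I f x v) (mfderiv I' I f x w) := rfl

set_option synthInstance.maxHeartbeats 200000 in
set_option maxHeartbeats 800000 in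
lemma contMDiff_pullback [IsManifold I' ∞ N] (g : SmoothMetric I M) {f : N → M} (hf : ContMDiff I' I ∞ f) :
    ContMDiff I' (I'.prod 𝓘(ℝ, E' →L[ℝ] E' →L[ℝ] ℝ)) ∞
      (fun x ↦ Bundle.TotalSpace.mk' (E' →L[ℝ] E' →L[ℝ] ℝ)
        (E := fun x : N ↦ TangentSpace I' x →L[ℝ] TangentSpace I' x →L[ℝ] ℝ) x
        (pullback g f x)) := by
  intro x₀
  rw [contMDiffAt_hom_bundle]
  refine ⟨contMDiffAt_id, ?_⟩
  have hg := (contMDiffAt_hom_bundle _).1 (g.contMDiff (f x₀))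
  have hG := hg.2.comp x₀ (hf x₀)
  have hD : ContMDiffAt I' 𝓘(ℝ, E' →L[ℝ] E) ∞
      (inTangentCoordinates I' I id f (fun x ↦ mfderiv I' I f x) x₀) x₀ :=
    (hf x₀).mfderiv_const (by simp)
  have hG' : ContMDiffAt I' 𝓘(ℝ, E →L[ℝ] E →L[ℝ] ℝ) ∞
      (fun x ↦ ContinuousLinearMap.inCoordinates E (TangentSpace I) (E →L[ℝ] ℝ)
        (fun y : M ↦ TangentSpace I y →L[ℝ] ℝ) (f x₀) (f x) (f x₀) (f x) (g.inner (f x))) x₀ := hG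
  have hP := hD.clm_precomp (F₃ := ℝ)
  have h2 := (hP.clm_comp hG').clm_comp hD
  refine h2.congr_of_eventuallyEq ?_
  have hx : ∀ᶠ x in 𝓝 x₀, x ∈ (trivializationAt E' (TangentSpace I') x₀).baseSet :=
    (trivializationAt E' (TangentSpace I') x₀).open_baseSet.mem_nhds
      (FiberBundle.mem_baseSet_trivializationAt' x₀)
  have hy : ∀ᶠ x in 𝓝 x₀, f x ∈ (trivializationAt E (TangentSpace I) (f x₀)).baseSet :=
    hf.continuous.continuousAt.preimage_mem_nhds
      ((trivializationAt E (TangentSpace I) (f x₀)).open_baseSet.mem_nhds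
        (FiberBundle.mem_baseSet_trivializationAt' (f x₀)))
  filter_upwards [hx, hy] with x hx hy
  ext v w
  have key : ∀ u : E', (trivializationAt E (TangentSpace I) (f x₀)).symm (f x)
      (inTangentCoordinates I' I id f (fun x ↦ mfderiv I' I f x) x₀ x u) =
      mfderiv I' I f x ((trivializationAt E' (TangentSpace I') x₀).symm x u) := by
    intro u
    refine (congrArg (fun A : E' →L[ℝ] E ↦
      (trivializationAt E (TangentSpace I) (f x₀)).symm (f x) (A u))
      (ContinuousLinearMap.inCoordinates_eq (ϕ := mfderiv I' I f x) hx hy)).trans ?_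
    exact ((trivializationAt E (TangentSpace I) (f x₀)).continuousLinearEquivAt ℝ
      (f x) hy).symm_apply_apply _
  have e1 := inCoordinates_apply_eq₂ (𝕜 := ℝ) (F₁ := E') (E₁ := (TangentSpace I' : N → Type _))
    (F₂ := E') (E₂ := (TangentSpace I' : N → Type _)) (F₃ := ℝ) (E₃ := fun _ : N ↦ ℝ)
    (ϕ := pullback g f x) (v := v) (w := w) hx hx (Set.mem_univ _)
  have e2 := inCoordinates_apply_eq₂ (𝕜 := ℝ) (F₁ := E) (E₁ := (TangentSpace I : M → Type _))
    (F₂ := E) (E₂ := (TangentSpace I : M → Type _)) (F₃ := ℝ) (E₃ := fun _ : M ↦ ℝ)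
    (ϕ := g.inner (f x))
    (v := inTangentCoordinates I' I id f (fun x ↦ mfderiv I' I f x) x₀ x v)
    (w := inTangentCoordinates I' I id f (fun x ↦ mfderiv I' I f x) x₀ x w)
    hy hy (Set.mem_univ _)
  rw [key, key] at e2
  refine e1.trans (Eq.trans ?_ e2.symm)
  simp [pullback_apply]

end Pullback

section Product

variable {E₁ : Type*} [NormedAddCommGroup E₁] [NormedSpace ℝ E₁]
  {H₁ : Type*} [TopologicalSpace H₁] {I₁ : ModelWithCorners ℝ E₁ H₁}
  {M₁ : Type*} [TopologicalSpace M₁] [ChartedSpace H₁ M₁] [IsManifold I₁ ∞ M₁]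
  {E₂ : Type*} [NormedAddCommGroup E₂] [NormedSpace ℝ E₂]
  {H₂ : Type*} [TopologicalSpace H₂] {I₂ : ModelWithCorners ℝ E₂ H₂}
  {M₂ : Type*} [TopologicalSpace M₂] [ChartedSpace H₂ M₂] [IsManifold I₂ ∞ M₂]

set_option synthInstance.maxHeartbeats 200000 in
/-- The product metric `π₁^* g₁ + π₂^* g₂` on `M₁ × M₂`. -/
def prodMetric (g₁ : SmoothMetric I₁ M₁) (g₂ : SmoothMetric I₂ M₂) : SmoothMetric (I₁.prod I₂) (M₁ × M₂) where
  inner p := pullback (I' := I₁.prod I₂) g₁ Prod.fst p + pullback (I' := I₁.prod I₂) g₂ Prod.snd p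
  symm p v w := by
    change g₁.inner p.1 _ _ + g₂.inner p.2 _ _ = g₁.inner p.1 _ _ + g₂.inner p.2 _ _
    rw [g₁.symm, g₂.symm]
  pos p v hv := by
    change 0 < g₁.inner p.1 _ _ + g₂.inner p.2 _ _
    rw [mfderiv_fst, mfderiv_snd]
    change 0 < g₁.inner p.1 v.1 v.1 + g₂.inner p.2 v.2 v.2
    have nn₁ : 0 ≤ g₁.inner p.1 v.1 v.1 := inner_self_nonneg g₁ p.1 v.1
    have nn₂ : 0 ≤ g₂.inner p.2 v.2 v.2 := inner_self_nonneg g₂ p.2 v.2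
    by_cases h : v.1 = 0
    · have h' : v.2 ≠ 0 := fun h' ↦ hv (Prod.ext h h')
      exact add_pos_of_nonneg_of_pos nn₁ (g₂.pos p.2 v.2 h')
    · exact add_pos_of_pos_of_nonneg (g₁.pos p.1 v.1 h) nn₂
  isVonNBounded p := by
    have b₁ : Bornology.IsVonNBounded ℝ {v : E₁ | g₁.inner p.1 v v < 1} := g₁.isVonNBounded p.1
    have b₂ : Bornology.IsVonNBounded ℝ {v : E₂ | g₂.inner p.2 v v < 1} := g₂.isVonNBounded p.2
    have b : Bornology.IsVonNBounded ℝ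
        ({v : E₁ | g₁.inner p.1 v v < 1} ×ˢ {v : E₂ | g₂.inner p.2 v v < 1}) := by
      rw [NormedSpace.isVonNBounded_iff] at b₁ b₂ ⊢
      exact b₁.prod b₂
    refine Bornology.IsVonNBounded.subset (E := E₁ × E₂) (fun v hv ↦ ?_) b
    change g₁.inner p.1 _ _ + g₂.inner p.2 _ _ < 1 at hv
    rw [mfderiv_fst, mfderiv_snd] at hv
    change g₁.inner p.1 v.1 v.1 + g₂.inner p.2 v.2 v.2 < 1 at hv
    exact ⟨(le_add_of_nonneg_right (inner_self_nonneg g₂ p.2 v.2)).trans_lt hv,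
      (le_add_of_nonneg_left (inner_self_nonneg g₁ p.1 v.1)).trans_lt hv⟩
  contMDiff := (contMDiff_pullback g₁ contMDiff_fst).add_section
    (contMDiff_pullback g₂ contMDiff_snd)

/-- The product metric is the orthogonal sum of the two metrics under
`T_{(p₁, p₂)} (M₁ × M₂) = T_{p₁} M₁ × T_{p₂} M₂`. -/
lemma prodMetric_inner (g₁ : SmoothMetric I₁ M₁) (g₂ : SmoothMetric I₂ M₂) (p : M₁ × M₂)
    (v w : TangentSpace (I₁.prod I₂) p) :
    (prodMetric g₁ g₂).inner p v w = g₁.inner p.1 v.1 w.1 + g₂.inner p.2 v.2 w.2 := by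
  change g₁.inner p.1 _ _ + g₂.inner p.2 _ _ = _
  rw [mfderiv_fst, mfderiv_snd]
  rfl

end Product

section Operators

variable {E : Type*} [NormedAddCommGroup E] [NormedSpace ℝ E] [FiniteDimensional ℝ E]
  {H : Type*} [TopologicalSpace H] {I : ModelWithCorners ℝ E H}
  {M : Type*} [TopologicalSpace M] [ChartedSpace H M] [IsManifold I ∞ M]

/-- The `i`-th coordinate vector field `∂/∂x_i` of the chart at `p`, at the point of `M` with
coordinates `y`. The coordinates are those of a fixed basis of the model space `E`. -/
def coordField (I : ModelWithCorners ℝ E H) {M : Type*} [TopologicalSpace M] [ChartedSpace H M]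
    (p : M) (i : Fin (Module.finrank ℝ E)) (y : E) :
    TangentSpace I ((extChartAt I p).symm y) :=
  mfderiv 𝓘(ℝ, E) I (extChartAt I p).symm y (Module.finBasis ℝ E i)

/-- The matrix `(g_ij)` of the metric in the coordinates of the chart at `p`, as a function of
the coordinates `y`. -/
def coordMetric (g : SmoothMetric I M) (p : M) (y : E) :
    Matrix (Fin (Module.finrank ℝ E)) (Fin (Module.finrank ℝ E)) ℝ :=
  Matrix.of fun i j ↦
    g.inner ((extChartAt I p).symm y) (coordField I p i y) (coordField I p j y)

/-- The partial derivative `∂φ/∂x_i` in the coordinates of the chart at `p`, as a function of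
the coordinates `y`. -/
def coordDeriv (I : ModelWithCorners ℝ E H) {M : Type*} [TopologicalSpace M] [ChartedSpace H M]
    (φ : M → ℂ) (p : M) (i : Fin (Module.finrank ℝ E)) (y : E) : ℂ :=
  fderiv ℝ (φ ∘ (extChartAt I p).symm) y (Module.finBasis ℝ E i)

/-- The Laplace-Beltrami operator (tension field)
`τ(φ) = ∑_{i,j} (1/√|g|) ∂/∂x_j (g^{ij} √|g| ∂φ/∂x_i)`, evaluated at each point `p` in the
coordinates of the preferred chart `extChartAt I p` around `p` (for smooth `φ` on a manifold without
boundary the value is the same in all local coordinates). -/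
def tension (g : SmoothMetric I M) (φ : M → ℂ) (p : M) : ℂ :=
  ∑ i, ∑ j, ((1 / √(coordMetric g p (extChartAt I p p)).det : ℝ) : ℂ) *
    fderiv ℝ (fun y ↦ (((coordMetric g p y)⁻¹ i j * √(coordMetric g p y).det : ℝ) : ℂ) *
      coordDeriv I φ p i y) (extChartAt I p p) (Module.finBasis ℝ E j)

/-- The conformality operator `κ(φ, ψ) = g(∇φ, ∇ψ) = ∑_{i,j} g^{ij} ∂φ/∂x_i ∂ψ/∂x_j`
(`g` extended complex bilinearly), evaluated at each point `p` in the coordinates of the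
preferred chart around `p`. -/
def conformality (g : SmoothMetric I M) (φ ψ : M → ℂ) (p : M) : ℂ :=
  ∑ i, ∑ j, (((coordMetric g p (extChartAt I p p))⁻¹ i j : ℝ) : ℂ) *
    coordDeriv I φ p i (extChartAt I p p) * coordDeriv I ψ p j (extChartAt I p p)

/-- A set `𝓔` of smooth complex-valued functions on `(M, g)` is a `(lam, mu)`-eigenfamily if
`τ(φ) = lam φ` and `κ(φ, ψ) = mu φ ψ` for all `φ, ψ ∈ 𝓔`. -/
structure IsEigenfamily (g : SmoothMetric I M) (lam mu : ℂ) (𝓔 : Set (M → ℂ)) : Prop where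
  smooth : ∀ φ ∈ 𝓔, ContMDiff I 𝓘(ℝ, ℂ) ∞ φ
  tension_eq : ∀ φ ∈ 𝓔, ∀ p, tension g φ p = lam * φ p
  conformality_eq : ∀ φ ∈ 𝓔, ∀ ψ ∈ 𝓔, ∀ p, conformality g φ ψ p = mu * (φ p * ψ p)

end Operators

end EigenFamily

end

noncomputable section

namespace EigenFamily

section LocalOperators

variable {E : Type*} [NormedAddCommGroup E] [NormedSpace ℝ E]
  {ι κ : Type*} [Fintype ι] [DecidableEq ι] [Fintype κ] [DecidableEq κ]

/-- The Gram matrix of a bilinear form in a basis. -/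
def gram (b : Module.Basis ι ℝ E) (B : E →L[ℝ] E →L[ℝ] ℝ) : Matrix ι ι ℝ :=
  Matrix.of fun i j ↦ B (b i) (b j)

/-- The Laplace-Beltrami operator of a field of bilinear forms on a vector space, in the linear
coordinates of a basis. -/
def localTension (b : Module.Basis ι ℝ E) (B : E → E →L[ℝ] E →L[ℝ] ℝ) (f : E → ℂ) (x : E) : ℂ :=
  ∑ i, ∑ j, ((1 / √(gram b (B x)).det : ℝ) : ℂ) *
    fderiv ℝ (fun y ↦ (((gram b (B y))⁻¹ i j * √(gram b (B y)).det : ℝ) : ℂ) *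
      fderiv ℝ f y (b i)) x (b j)

/-- The conformality operator of a bilinear form on a vector space, in the linear coordinates of a
basis. -/
def localConformality (b : Module.Basis ι ℝ E) (B : E →L[ℝ] E →L[ℝ] ℝ) (f h : E → ℂ) (x : E) : ℂ :=
  ∑ i, ∑ j, (((gram b B)⁻¹ i j : ℝ) : ℂ) * fderiv ℝ f x (b i) * fderiv ℝ h x (b j)

/-- The `j`-th component of the gradient of `f` multiplied by the volume density. -/
def localFlux (b : Module.Basis ι ℝ E) (B : E → E →L[ℝ] E →L[ℝ] ℝ) (f : E → ℂ) (j : ι) (y : E) : ℂ :=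
  ∑ i, (((gram b (B y))⁻¹ i j * √(gram b (B y)).det : ℝ) : ℂ) * fderiv ℝ f y (b i)

omit [DecidableEq ι] [Fintype κ] [DecidableEq κ] in
lemma gram_change (b : Module.Basis ι ℝ E) (c : Module.Basis κ ℝ E) (B : E →L[ℝ] E →L[ℝ] ℝ) :
    gram c B = (b.toMatrix c).transpose * gram b B * b.toMatrix c := by
  ext i j
  rw [Matrix.mul_assoc, Matrix.mul_apply]
  simp only [gram, Matrix.of_apply, Matrix.mul_apply, Matrix.transpose_apply]
  conv_lhs => rw [← b.sum_toMatrix_smul_self c i, ← b.sum_toMatrix_smul_self c j]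
  simp only [map_sum, map_smul, sum_apply, smul_apply,
    smul_eq_mul]
  simp only [Finset.mul_sum]
  rw [Finset.sum_comm]
  refine Finset.sum_congr rfl fun k _ ↦ Finset.sum_congr rfl fun l _ ↦ ?_
  ring

lemma gram_inv_change (b : Module.Basis ι ℝ E) (c : Module.Basis κ ℝ E)
    {B : E →L[ℝ] E →L[ℝ] ℝ} (h : (gram b B).det ≠ 0) :
    (gram c B)⁻¹ = c.toMatrix b * (gram b B)⁻¹ * (c.toMatrix b).transpose := by
  apply Matrix.inv_eq_right_inv
  have h1 : b.toMatrix c * c.toMatrix b = 1 := b.toMatrix_mul_toMatrix_flip c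
  have h2 : c.toMatrix b * b.toMatrix c = 1 := c.toMatrix_mul_toMatrix_flip b
  calc gram c B * (c.toMatrix b * (gram b B)⁻¹ * (c.toMatrix b).transpose)
      = (b.toMatrix c).transpose * (gram b B * (b.toMatrix c * c.toMatrix b) * (gram b B)⁻¹) *
        (c.toMatrix b).transpose := by
        rw [gram_change b c]; simp only [Matrix.mul_assoc]
    _ = 1 := by
        rw [h1, Matrix.mul_one, Matrix.mul_nonsing_inv _ (isUnit_iff_ne_zero.2 h), Matrix.mul_one,
          ← Matrix.transpose_mul, h2, Matrix.transpose_one]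

lemma exists_sqrt_det_gram_change (b : Module.Basis ι ℝ E) (c : Module.Basis κ ℝ E) :
    ∃ r : ℝ, 0 < r ∧ ∀ B, √(gram c B).det = r * √(gram b B).det := by
  let e : κ ≃ ι := c.indexEquiv b
  have h1 : b.toMatrix (c.reindex e) * (c.reindex e).toMatrix b = 1 :=
    b.toMatrix_mul_toMatrix_flip _
  have h2 : (b.toMatrix (c.reindex e)).det ≠ 0 := fun h0 ↦ by
    have := congrArg Matrix.det h1
    rw [Matrix.det_mul, h0, zero_mul, Matrix.det_one] at this
    exact zero_ne_one this
  refine ⟨|(b.toMatrix (c.reindex e)).det|, abs_pos.2 h2, fun B ↦ ?_⟩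
  have h3 : (gram c B).det = (gram (c.reindex e) B).det := by
    rw [← Matrix.det_submatrix_equiv_self e.symm]
    congr 1
    ext i j
    simp [gram]
  rw [h3, gram_change b, Matrix.det_mul, Matrix.det_mul, Matrix.det_transpose, mul_right_comm,
    ← sq, Real.sqrt_mul (sq_nonneg _), Real.sqrt_sq_eq_abs]

omit [Fintype ι] [DecidableEq ι] [DecidableEq κ] in
lemma apply_basis_eq_sum {F : Type*} [AddCommGroup F] [Module ℝ F] [TopologicalSpace F]
    (b : Module.Basis ι ℝ E) (c : Module.Basis κ ℝ E) (L : E →L[ℝ] F) (k : ι) :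
    L (b k) = ∑ i, c.toMatrix b i k • L (c i) := by
  rw [← c.sum_toMatrix_smul_self b k, map_sum]
  simp

omit [DecidableEq ι] [DecidableEq κ] in
lemma sum_reverse₄ (F : κ → κ → ι → ι → ℂ) :
    ∑ i, ∑ j, ∑ l, ∑ k, F i j l k = ∑ k, ∑ l, ∑ j, ∑ i, F i j l k := by
  have h (G : κ → κ → ι → ι → ℂ) :
      ∑ i, ∑ j, ∑ l, ∑ k, G i j l k = ∑ l, ∑ k, ∑ i, ∑ j, G i j l k := by
    calc _ = ∑ i, ∑ l, ∑ j, ∑ k, G i j l k := Finset.sum_congr rfl fun _ _ ↦ Finset.sum_comm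
      _ = ∑ l, ∑ i, ∑ k, ∑ j, G i j l k := Finset.sum_comm.trans <|
        Finset.sum_congr rfl fun _ _ ↦ Finset.sum_congr rfl fun _ _ ↦ Finset.sum_comm
      _ = _ := Finset.sum_congr rfl fun _ _ ↦ Finset.sum_comm
  rw [h, Finset.sum_comm]
  exact Finset.sum_congr rfl fun _ _ ↦ Finset.sum_congr rfl fun _ _ ↦ Finset.sum_comm

lemma localConformality_change (b : Module.Basis ι ℝ E) (c : Module.Basis κ ℝ E)
    {B : E →L[ℝ] E →L[ℝ] ℝ} (hB : (gram b B).det ≠ 0) (f h : E → ℂ) (x : E) :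
    localConformality c B f h x = localConformality b B f h x := by
  simp only [localConformality, gram_inv_change b c hB, apply_basis_eq_sum b c, Matrix.mul_apply,
    Matrix.transpose_apply, Complex.real_smul, Complex.ofReal_sum, Complex.ofReal_mul,
    Finset.sum_mul, Finset.mul_sum]
  rw [sum_reverse₄]
  refine Finset.sum_congr rfl fun k _ ↦ Finset.sum_congr rfl fun l _ ↦
    Finset.sum_congr rfl fun j _ ↦ Finset.sum_congr rfl fun i _ ↦ ?_
  ring

lemma localFlux_change (b : Module.Basis ι ℝ E) (c : Module.Basis κ ℝ E) {r : ℝ}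
    (hr : ∀ B, √(gram c B).det = r * √(gram b B).det) {B : E → E →L[ℝ] E →L[ℝ] ℝ} {y : E}
    (hB : (gram b (B y)).det ≠ 0) (f : E → ℂ) (j : κ) :
    localFlux c B f j y = r * ∑ l, ((c.toMatrix b j l : ℝ) : ℂ) * localFlux b B f l y := by
  simp only [localFlux, hr, gram_inv_change b c hB, apply_basis_eq_sum b c, Matrix.mul_apply,
    Matrix.transpose_apply, Complex.real_smul, Complex.ofReal_sum, Complex.ofReal_mul,
    Finset.sum_mul, Finset.mul_sum]
  rw [Finset.sum_comm]
  refine Finset.sum_congr rfl fun l _ ↦ ?_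
  rw [Finset.sum_comm]
  refine Finset.sum_congr rfl fun k _ ↦ Finset.sum_congr rfl fun i _ ↦ ?_
  ring

/-- A field of bilinear forms that is differentiable and has positive Gram determinant at `x`. -/
structure IsMetricAt (B : E → E →L[ℝ] E →L[ℝ] ℝ) (x : E) : Prop where
  differentiableAt : ∀ v w, DifferentiableAt ℝ (fun y ↦ B y v w) x
  symm : ∀ v w, B x v w = B x w v
  pos : ∀ v, v ≠ 0 → 0 < B x v v

lemma differentiableAt_det {A : E → Matrix ι ι ℝ} {x : E}
    (hA : ∀ i j, DifferentiableAt ℝ (fun y ↦ A y i j) x) :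
    DifferentiableAt ℝ (fun y ↦ (A y).det) x := by
  simp only [Matrix.det_apply]
  fun_prop (disch := simp)

lemma differentiableAt_matrix_inv {A : E → Matrix ι ι ℝ} {x : E}
    (hA : ∀ i j, DifferentiableAt ℝ (fun y ↦ A y i j) x) (h0 : (A x).det ≠ 0) (i j : ι) :
    DifferentiableAt ℝ (fun y ↦ (A y)⁻¹ i j) x := by
  simp only [Matrix.inv_def, Matrix.smul_apply, Matrix.adjugate_apply, smul_eq_mul,
    Ring.inverse_eq_inv']
  refine ((differentiableAt_det hA).inv h0).mul (differentiableAt_det fun k l ↦ ?_)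
  by_cases hk : k = j
  · subst hk; simp
  · simpa [Matrix.updateRow_ne hk] using hA k l

namespace IsMetricAt

variable {B : E → E →L[ℝ] E →L[ℝ] ℝ} {x : E}

lemma det_pos (hB : IsMetricAt B x) (b : Module.Basis ι ℝ E) : 0 < (gram b (B x)).det := by
  refine Matrix.PosDef.det_pos ?_
  rw [Matrix.posDef_iff_dotProduct_mulVec]
  refine ⟨Matrix.IsHermitian.ext fun i j ↦ by simp [gram, hB.symm (b j)], fun v hv ↦ ?_⟩
  have h : (∑ i, v i • b i) ≠ 0 := fun h ↦ hv <| by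
    ext i
    exact Fintype.linearIndependent_iff.1 b.linearIndependent v h i
  convert! hB.pos _ h using 1
  simp [dotProduct, Matrix.mulVec, gram, Finset.mul_sum]
  rw [Finset.sum_comm]
  refine Finset.sum_congr rfl fun k _ ↦ Finset.sum_congr rfl fun i _ ↦ ?_
  ring

lemma differentiableAt_det_gram (hB : IsMetricAt B x) (b : Module.Basis ι ℝ E) :
    DifferentiableAt ℝ (fun y ↦ (gram b (B y)).det) x :=
  differentiableAt_det fun _ _ ↦ hB.differentiableAt _ _

lemma eventually_det_pos (hB : IsMetricAt B x) (b : Module.Basis ι ℝ E) :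
    ∀ᶠ y in 𝓝 x, 0 < (gram b (B y)).det :=
  (hB.differentiableAt_det_gram b).continuousAt.eventually_const_lt (hB.det_pos b)

lemma differentiableAt_sqrt_det (hB : IsMetricAt B x) (b : Module.Basis ι ℝ E) :
    DifferentiableAt ℝ (fun y ↦ √(gram b (B y)).det) x :=
  (hB.differentiableAt_det_gram b).sqrt (hB.det_pos b).ne'

lemma differentiableAt_coeff (hB : IsMetricAt B x) (b : Module.Basis ι ℝ E) {f : E → ℂ}
    (hf : ∀ v, DifferentiableAt ℝ (fun y ↦ fderiv ℝ f y v) x) (i j : ι) :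
    DifferentiableAt ℝ (fun y ↦ (((gram b (B y))⁻¹ i j * √(gram b (B y)).det : ℝ) : ℂ) *
      fderiv ℝ f y (b i)) x := by
  refine DifferentiableAt.mul ?_ (hf _)
  refine Complex.ofRealCLM.differentiableAt.comp x (DifferentiableAt.mul ?_ ?_)
  · exact differentiableAt_matrix_inv (fun _ _ ↦ hB.differentiableAt _ _) (hB.det_pos b).ne' i j
  · exact hB.differentiableAt_sqrt_det b

lemma differentiableAt_localFlux (hB : IsMetricAt B x) (b : Module.Basis ι ℝ E) {f : E → ℂ}
    (hf : ∀ v, DifferentiableAt ℝ (fun y ↦ fderiv ℝ f y v) x) (j : ι) :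
    DifferentiableAt ℝ (localFlux b B f j) x :=
  DifferentiableAt.fun_sum fun i _ ↦ hB.differentiableAt_coeff b hf i j

lemma localTension_eq_sum_fderiv_localFlux (hB : IsMetricAt B x) (b : Module.Basis ι ℝ E)
    {f : E → ℂ} (hf : ∀ v, DifferentiableAt ℝ (fun y ↦ fderiv ℝ f y v) x) :
    localTension b B f x = ((1 / √(gram b (B x)).det : ℝ) : ℂ) *
      ∑ j, fderiv ℝ (localFlux b B f j) x (b j) := by
  rw [localTension, Finset.sum_comm, Finset.mul_sum]
  refine Finset.sum_congr rfl fun j _ ↦ ?_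
  rw [← Finset.mul_sum]
  unfold localFlux
  rw [fderiv_fun_sum fun i _ ↦ hB.differentiableAt_coeff b hf i j, sum_apply]

theorem localTension_change (hB : IsMetricAt B x) (b : Module.Basis ι ℝ E)
    (c : Module.Basis κ ℝ E) {f : E → ℂ}
    (hf : ∀ v, DifferentiableAt ℝ (fun y ↦ fderiv ℝ f y v) x) :
    localTension c B f x = localTension b B f x := by
  obtain ⟨r, hr0, hr⟩ := exists_sqrt_det_gram_change b c
  rw [hB.localTension_eq_sum_fderiv_localFlux b hf, hB.localTension_eq_sum_fderiv_localFlux c hf]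
  have key : ∀ j, fderiv ℝ (localFlux c B f j) x =
      (r : ℂ) • ∑ l, ((c.toMatrix b j l : ℝ) : ℂ) • fderiv ℝ (localFlux b B f l) x := by
    intro j
    have h : localFlux c B f j =ᶠ[𝓝 x]
        fun y ↦ (r : ℂ) * ∑ l, ((c.toMatrix b j l : ℝ) : ℂ) * localFlux b B f l y := by
      filter_upwards [hB.eventually_det_pos b] with y hy
      exact localFlux_change b c hr hy.ne' f j
    have hd := hB.differentiableAt_localFlux b hf
    rw [h.fderiv_eq, fderiv_const_mul (DifferentiableAt.fun_sum fun l _ ↦ (hd l).const_mul _),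
      fderiv_fun_sum fun l _ ↦ (hd l).const_mul _]
    simp only [fderiv_const_mul (hd _)]
  simp only [key, hr, apply_basis_eq_sum b c, smul_apply,
    sum_apply, Complex.real_smul, smul_eq_mul]
  rw [← Finset.mul_sum, ← mul_assoc, Finset.sum_comm]
  congr 1
  have : (r : ℂ) ≠ 0 := by exact_mod_cast hr0.ne'
  push_cast
  rw [one_div, one_div, mul_inv]
  field_simp

end IsMetricAt

end LocalOperators

section LocalProduct

variable {E₁ E₂ : Type*} [NormedAddCommGroup E₁] [NormedSpace ℝ E₁]
  [NormedAddCommGroup E₂] [NormedSpace ℝ E₂]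
  {ι₁ ι₂ : Type*} [Fintype ι₁] [DecidableEq ι₁] [Fintype ι₂] [DecidableEq ι₂]
  {f₁ : E₁ → ℂ} {f₂ : E₂ → ℂ} {x : E₁ × E₂}

lemma fderiv_mul_prod (h₁ : DifferentiableAt ℝ f₁ x.1) (h₂ : DifferentiableAt ℝ f₂ x.2)
    (v : E₁ × E₂) :
    fderiv ℝ (fun y : E₁ × E₂ ↦ f₁ y.1 * f₂ y.2) x v =
      fderiv ℝ f₁ x.1 v.1 * f₂ x.2 + f₁ x.1 * fderiv ℝ f₂ x.2 v.2 := by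
  have d₁ := h₁.hasFDerivAt.comp x hasFDerivAt_fst
  have d₂ := h₂.hasFDerivAt.comp x hasFDerivAt_snd
  have := (d₁.mul d₂).fderiv
  refine (congrArg (fun L : E₁ × E₂ →L[ℝ] ℂ ↦ L v) this).trans ?_
  simp
  ring

lemma eventually_differentiableAt_of_contDiffAt {E : Type*} [NormedAddCommGroup E]
    [NormedSpace ℝ E] {f : E → ℂ} {x : E} (h : ContDiffAt ℝ ∞ f x) :
    ∀ᶠ y in 𝓝 x, DifferentiableAt ℝ f y := by
  have h1 : ContDiffAt ℝ 1 f x := h.of_le (by exact_mod_cast le_top)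
  exact (h1.eventually (by simp)).mono fun _ hy ↦ hy.differentiableAt one_ne_zero

lemma differentiableAt_fderiv_apply_of_contDiffAt {E : Type*} [NormedAddCommGroup E]
    [NormedSpace ℝ E] {f : E → ℂ} {x : E} (h : ContDiffAt ℝ ∞ f x) (v : E) :
    DifferentiableAt ℝ (fun y ↦ fderiv ℝ f y v) x := by
  have h1 : ContDiffAt ℝ 1 (fderiv ℝ f) x := h.fderiv_right (m := 1) (WithTop.coe_le_coe.2 le_top)
  exact (h1.differentiableAt one_ne_zero).clm_apply (differentiableAt_const v)

/-- `B` is the orthogonal sum of the forms `B₁` and `B₂`. -/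
def IsOrthogonalSum (B : E₁ × E₂ →L[ℝ] E₁ × E₂ →L[ℝ] ℝ) (B₁ : E₁ →L[ℝ] E₁ →L[ℝ] ℝ)
    (B₂ : E₂ →L[ℝ] E₂ →L[ℝ] ℝ) : Prop :=
  ∀ v w, B v w = B₁ v.1 w.1 + B₂ v.2 w.2

section OrthogonalSum

variable {B : E₁ × E₂ →L[ℝ] E₁ × E₂ →L[ℝ] ℝ} {B₁ : E₁ →L[ℝ] E₁ →L[ℝ] ℝ}
  {B₂ : E₂ →L[ℝ] E₂ →L[ℝ] ℝ} (b₁ : Module.Basis ι₁ ℝ E₁) (b₂ : Module.Basis ι₂ ℝ E₂)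

omit [Fintype ι₁] [DecidableEq ι₁] [Fintype ι₂] [DecidableEq ι₂] in
lemma IsOrthogonalSum.gram_prod (h : IsOrthogonalSum B B₁ B₂) :
    gram (b₁.prod b₂) B = Matrix.fromBlocks (gram b₁ B₁) 0 0 (gram b₂ B₂) := by
  ext (i | i) (j | j) <;> simp [gram, h _ _]

lemma IsOrthogonalSum.det_gram_prod (h : IsOrthogonalSum B B₁ B₂) :
    (gram (b₁.prod b₂) B).det = (gram b₁ B₁).det * (gram b₂ B₂).det := by
  rw [h.gram_prod, Matrix.det_fromBlocks_zero₂₁]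

lemma IsOrthogonalSum.inv_gram_prod (h : IsOrthogonalSum B B₁ B₂)
    (h₁ : (gram b₁ B₁).det ≠ 0) (h₂ : (gram b₂ B₂).det ≠ 0) :
    (gram (b₁.prod b₂) B)⁻¹ = Matrix.fromBlocks (gram b₁ B₁)⁻¹ 0 0 (gram b₂ B₂)⁻¹ := by
  apply Matrix.inv_eq_right_inv
  rw [h.gram_prod, Matrix.fromBlocks_multiply]
  simp [Matrix.mul_nonsing_inv, h₁, h₂]

theorem localConformality_mul_prod (h : IsOrthogonalSum B B₁ B₂)
    (h₁ : (gram b₁ B₁).det ≠ 0) (h₂ : (gram b₂ B₂).det ≠ 0) {k₁ : E₁ → ℂ} {k₂ : E₂ → ℂ}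
    (hf₁ : DifferentiableAt ℝ f₁ x.1) (hf₂ : DifferentiableAt ℝ f₂ x.2)
    (hk₁ : DifferentiableAt ℝ k₁ x.1) (hk₂ : DifferentiableAt ℝ k₂ x.2) :
    localConformality (b₁.prod b₂) B (fun y ↦ f₁ y.1 * f₂ y.2) (fun y ↦ k₁ y.1 * k₂ y.2) x =
      localConformality b₁ B₁ f₁ k₁ x.1 * (f₂ x.2 * k₂ x.2) +
      (f₁ x.1 * k₁ x.1) * localConformality b₂ B₂ f₂ k₂ x.2 := by
  simp only [localConformality, h.inv_gram_prod b₁ b₂ h₁ h₂, fderiv_mul_prod hf₁ hf₂,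
    fderiv_mul_prod hk₁ hk₂, Fintype.sum_sum_type, Matrix.fromBlocks_apply₁₁,
    Matrix.fromBlocks_apply₁₂, Matrix.fromBlocks_apply₂₁, Matrix.fromBlocks_apply₂₂,
    Module.Basis.prod_apply_inl_fst, Module.Basis.prod_apply_inl_snd,
    Module.Basis.prod_apply_inr_fst, Module.Basis.prod_apply_inr_snd, map_zero, mul_zero,
    zero_mul, add_zero, zero_add, Matrix.zero_apply, Complex.ofReal_zero, Finset.sum_const_zero,
    Finset.sum_mul, Finset.mul_sum]
  congr 1 <;> exact Finset.sum_congr rfl fun i _ ↦ Finset.sum_congr rfl fun j _ ↦ by ring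

end OrthogonalSum

variable {B : E₁ × E₂ → E₁ × E₂ →L[ℝ] E₁ × E₂ →L[ℝ] ℝ} {B₁ : E₁ → E₁ →L[ℝ] E₁ →L[ℝ] ℝ}
  {B₂ : E₂ → E₂ →L[ℝ] E₂ →L[ℝ] ℝ} (b₁ : Module.Basis ι₁ ℝ E₁) (b₂ : Module.Basis ι₂ ℝ E₂)

lemma IsMetricAt.prod (hB₁ : IsMetricAt B₁ x.1) (hB₂ : IsMetricAt B₂ x.2)
    (h : ∀ᶠ y in 𝓝 x, IsOrthogonalSum (B y) (B₁ y.1) (B₂ y.2)) : IsMetricAt B x where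
  differentiableAt v w := by
    refine DifferentiableAt.congr_of_eventuallyEq
      (f := fun y ↦ B₁ y.1 v.1 w.1 + B₂ y.2 v.2 w.2) ?_ (h.mono fun y hy ↦ hy v w)
    exact ((hB₁.differentiableAt v.1 w.1).comp x differentiableAt_fst).add
      ((hB₂.differentiableAt v.2 w.2).comp x differentiableAt_snd)
  symm v w := by rw [h.self_of_nhds, h.self_of_nhds, hB₁.symm, hB₂.symm]
  pos v hv := by
    have nn₁ : 0 ≤ B₁ x.1 v.1 v.1 := by
      by_cases h0 : v.1 = 0
      · simp [h0]
      · exact (hB₁.pos _ h0).le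
    rw [h.self_of_nhds]
    by_cases h2 : v.2 = 0
    · have h1 : v.1 ≠ 0 := fun h1 ↦ hv (Prod.ext h1 h2)
      simpa [h2] using hB₁.pos _ h1
    · exact add_pos_of_nonneg_of_pos nn₁ (hB₂.pos _ h2)

lemma localFlux_mul_prod {y : E₁ × E₂} (h : IsOrthogonalSum (B y) (B₁ y.1) (B₂ y.2))
    (h₁ : 0 < (gram b₁ (B₁ y.1)).det) (h₂ : 0 < (gram b₂ (B₂ y.2)).det)
    (hf₁ : DifferentiableAt ℝ f₁ y.1) (hf₂ : DifferentiableAt ℝ f₂ y.2) :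
    (∀ j, localFlux (b₁.prod b₂) B (fun y ↦ f₁ y.1 * f₂ y.2) (Sum.inl j) y =
      localFlux b₁ B₁ f₁ j y.1 * ((√(gram b₂ (B₂ y.2)).det : ℝ) * f₂ y.2)) ∧
    (∀ j, localFlux (b₁.prod b₂) B (fun y ↦ f₁ y.1 * f₂ y.2) (Sum.inr j) y =
      ((√(gram b₁ (B₁ y.1)).det : ℝ) * f₁ y.1) * localFlux b₂ B₂ f₂ j y.2) := by
  constructor <;> intro j <;>
  · simp only [localFlux, h.inv_gram_prod b₁ b₂ h₁.ne' h₂.ne', h.det_gram_prod b₁ b₂,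
      Real.sqrt_mul h₁.le, fderiv_mul_prod hf₁ hf₂, Fintype.sum_sum_type,
      Matrix.fromBlocks_apply₁₁, Matrix.fromBlocks_apply₁₂, Matrix.fromBlocks_apply₂₁,
      Matrix.fromBlocks_apply₂₂, Module.Basis.prod_apply_inl_fst,
      Module.Basis.prod_apply_inl_snd, Module.Basis.prod_apply_inr_fst,
      Module.Basis.prod_apply_inr_snd, map_zero, mul_zero, zero_mul, add_zero, zero_add,
      Matrix.zero_apply, Complex.ofReal_zero, Finset.sum_const_zero, Finset.sum_mul,
      Finset.mul_sum, Complex.ofReal_mul]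
    exact Finset.sum_congr rfl fun i _ ↦ by ring

theorem localTension_mul_prod (hB₁ : IsMetricAt B₁ x.1) (hB₂ : IsMetricAt B₂ x.2)
    (h : ∀ᶠ y in 𝓝 x, IsOrthogonalSum (B y) (B₁ y.1) (B₂ y.2))
    (hf₁ : ContDiffAt ℝ ∞ f₁ x.1) (hf₂ : ContDiffAt ℝ ∞ f₂ x.2) :
    localTension (b₁.prod b₂) B (fun y ↦ f₁ y.1 * f₂ y.2) x =
      localTension b₁ B₁ f₁ x.1 * f₂ x.2 + f₁ x.1 * localTension b₂ B₂ f₂ x.2 := by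
  have hf : ContDiffAt ℝ ∞ (fun y : E₁ × E₂ ↦ f₁ y.1 * f₂ y.2) x :=
    (hf₁.comp x contDiffAt_fst).mul (hf₂.comp x contDiffAt_snd)
  have d₁ := differentiableAt_fderiv_apply_of_contDiffAt hf₁
  have d₂ := differentiableAt_fderiv_apply_of_contDiffAt hf₂
  have ev : ∀ᶠ y in 𝓝 x, IsOrthogonalSum (B y) (B₁ y.1) (B₂ y.2) ∧
      0 < (gram b₁ (B₁ y.1)).det ∧ 0 < (gram b₂ (B₂ y.2)).det ∧
      DifferentiableAt ℝ f₁ y.1 ∧ DifferentiableAt ℝ f₂ y.2 :=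
    h.and <| (continuousAt_fst.eventually (hB₁.eventually_det_pos b₁)).and <|
      (continuousAt_snd.eventually (hB₂.eventually_det_pos b₂)).and <|
      (continuousAt_fst.eventually (eventually_differentiableAt_of_contDiffAt hf₁)).and
      (continuousAt_snd.eventually (eventually_differentiableAt_of_contDiffAt hf₂))
  have s₁ : DifferentiableAt ℝ (fun y ↦ ((√(gram b₁ (B₁ y)).det : ℝ) : ℂ) * f₁ y) x.1 :=
    (Complex.ofRealCLM.differentiableAt.comp x.1 (hB₁.differentiableAt_sqrt_det b₁)).mul
      (hf₁.differentiableAt (by simp))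
  have s₂ : DifferentiableAt ℝ (fun y ↦ ((√(gram b₂ (B₂ y)).det : ℝ) : ℂ) * f₂ y) x.2 :=
    (Complex.ofRealCLM.differentiableAt.comp x.2 (hB₂.differentiableAt_sqrt_det b₂)).mul
      (hf₂.differentiableAt (by simp))
  have e₁ (j) : fderiv ℝ (localFlux (b₁.prod b₂) B (fun y ↦ f₁ y.1 * f₂ y.2) (Sum.inl j)) x
      (b₁.prod b₂ (Sum.inl j)) = fderiv ℝ (localFlux b₁ B₁ f₁ j) x.1 (b₁ j) *
        ((√(gram b₂ (B₂ x.2)).det : ℝ) * f₂ x.2) := by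
    rw [Filter.EventuallyEq.fderiv_eq (ev.mono fun y hy ↦ (localFlux_mul_prod b₁ b₂ hy.1 hy.2.1 hy.2.2.1 hy.2.2.2.1
      hy.2.2.2.2).1 j),
      fderiv_mul_prod (hB₁.differentiableAt_localFlux b₁ d₁ j) s₂]
    simp
  have e₂ (j) : fderiv ℝ (localFlux (b₁.prod b₂) B (fun y ↦ f₁ y.1 * f₂ y.2) (Sum.inr j)) x
      (b₁.prod b₂ (Sum.inr j)) = ((√(gram b₁ (B₁ x.1)).det : ℝ) * f₁ x.1) *
        fderiv ℝ (localFlux b₂ B₂ f₂ j) x.2 (b₂ j) := by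
    rw [Filter.EventuallyEq.fderiv_eq (ev.mono fun y hy ↦ (localFlux_mul_prod b₁ b₂ hy.1 hy.2.1 hy.2.2.1 hy.2.2.2.1
      hy.2.2.2.2).2 j),
      fderiv_mul_prod s₁ (hB₂.differentiableAt_localFlux b₂ d₂ j)]
    simp
  rw [(hB₁.prod hB₂ h).localTension_eq_sum_fderiv_localFlux _
      (differentiableAt_fderiv_apply_of_contDiffAt hf),
    hB₁.localTension_eq_sum_fderiv_localFlux b₁ d₁, hB₂.localTension_eq_sum_fderiv_localFlux b₂ d₂,
    Fintype.sum_sum_type]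
  simp only [e₁, e₂]
  rw [← Finset.sum_mul, ← Finset.mul_sum, h.self_of_nhds.det_gram_prod b₁ b₂,
    Real.sqrt_mul (hB₁.det_pos b₁).le]
  have n₁ : ((√(gram b₁ (B₁ x.1)).det : ℝ) : ℂ) ≠ 0 := by
    exact_mod_cast (Real.sqrt_pos.2 (hB₁.det_pos b₁)).ne'
  have n₂ : ((√(gram b₂ (B₂ x.2)).det : ℝ) : ℂ) ≠ 0 := by
    exact_mod_cast (Real.sqrt_pos.2 (hB₂.det_pos b₂)).ne'
  push_cast
  field_simp

end LocalProduct

section Coordinates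

variable {E : Type*} [NormedAddCommGroup E] [NormedSpace ℝ E]
  {H : Type*} [TopologicalSpace H] {I : ModelWithCorners ℝ E H}
  {M : Type*} [TopologicalSpace M] [ChartedSpace H M]

lemma extChartAt_target_mem_nhds_of_boundaryless [BoundarylessManifold I M] (p : M) :
    (extChartAt I p).target ∈ 𝓝 (extChartAt I p p) := by
  have h := extChartAt_target_mem_nhdsWithin (I := I) p
  rwa [nhdsWithin_eq_nhds.2 (range_mem_nhds_isInteriorPoint
    (BoundarylessManifold.isInteriorPoint (I := I)))] at h

variable [IsManifold I ∞ M]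

lemma contMDiffAt_extChartAt_symm_of_mem_nhds {p : M} {y : E}
    (hy : (extChartAt I p).target ∈ 𝓝 y) :
    ContMDiffAt 𝓘(ℝ, E) I ∞ (extChartAt I p).symm y :=
  (contMDiffOn_extChartAt_symm p).contMDiffAt hy

/-- The metric in the coordinates of the chart at `p`, as a field of bilinear forms on the model
space. -/
def coordForm (g : SmoothMetric I M) (p : M) (y : E) : E →L[ℝ] E →L[ℝ] ℝ :=
  pullback (I' := 𝓘(ℝ, E)) g (extChartAt I p).symm y

lemma contMDiffAt_mfderiv_apply {f : E → M} {y : E} (hf : ContMDiffAt 𝓘(ℝ, E) I ∞ f y) (v : E) :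
    ContMDiffAt 𝓘(ℝ, E) I.tangent ∞
      (fun z ↦ (⟨f z, mfderiv 𝓘(ℝ, E) I f z v⟩ : TangentBundle I M)) y := by
  have hD : ContMDiffAt 𝓘(ℝ, E) 𝓘(ℝ, E →L[ℝ] E) ∞
      (inTangentCoordinates 𝓘(ℝ, E) I id f (fun z ↦ mfderiv 𝓘(ℝ, E) I f z) y) y :=
    hf.mfderiv_const (by simp)
  have hv : ContMDiffAt 𝓘(ℝ, E) 𝓘(ℝ, E).tangent ∞
      (fun z : E ↦ (⟨z, v⟩ : TangentBundle 𝓘(ℝ, E) E)) y :=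
    contMDiffAt_vectorSpace_iff_contDiffAt.2 contDiffAt_const
  exact ContMDiffAt.clm_apply_of_inCoordinates (b₁ := id) hD hv hf

lemma differentiableAt_pullback_apply (g : SmoothMetric I M) {f : E → M} {y : E}
    (hf : ContMDiffAt 𝓘(ℝ, E) I ∞ f y) (v w : E) :
    DifferentiableAt ℝ (fun z ↦ g.inner (f z) (mfderiv 𝓘(ℝ, E) I f z v)
      (mfderiv 𝓘(ℝ, E) I f z w)) y := by
  have h := ContMDiffAt.clm_bundle_apply₂ (F₃ := ℝ) (E₃ := fun _ : M ↦ ℝ)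
    ((g.contMDiff (f y)).comp y hf)
    (contMDiffAt_mfderiv_apply hf v) (contMDiffAt_mfderiv_apply hf w)
  have h2 := Bundle.contMDiffAt_totalSpace.1 h
  exact (contMDiffAt_iff_contDiffAt.1 h2.2).differentiableAt (by simp)

lemma isMetricAt_coordForm [BoundarylessManifold I M] (g : SmoothMetric I M) (p : M) :
    IsMetricAt (coordForm g p) (extChartAt I p p) where
  differentiableAt v w := differentiableAt_pullback_apply g
    (contMDiffAt_extChartAt_symm_of_mem_nhds (extChartAt_target_mem_nhds_of_boundaryless p)) v w
  symm v w := g.symm _ _ _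
  pos v hv := by
    refine g.pos _ _ fun h0 ↦ hv ?_
    have hinv := isInvertible_mfderivWithin_extChartAt_symm (I := I) (mem_extChartAt_target p)
    rw [mfderivWithin_of_mem_nhds (range_mem_nhds_isInteriorPoint
      (BoundarylessManifold.isInteriorPoint (I := I)))] at hinv
    exact hinv.injective (h0.trans (map_zero _).symm)

lemma contDiffAt_comp_extChartAt_symm [BoundarylessManifold I M] {φ : M → ℂ}
    (hφ : ContMDiff I 𝓘(ℝ, ℂ) ∞ φ) (p : M) :
    ContDiffAt ℝ ∞ (φ ∘ (extChartAt I p).symm) (extChartAt I p p) :=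
  contMDiffAt_iff_contDiffAt.1 <| (hφ _).comp _ <|
    contMDiffAt_extChartAt_symm_of_mem_nhds (extChartAt_target_mem_nhds_of_boundaryless p)

lemma tension_eq_localTension [FiniteDimensional ℝ E] [BoundarylessManifold I M]
    {ι : Type*} [Fintype ι] [DecidableEq ι] (b : Module.Basis ι ℝ E)
    (g : SmoothMetric I M) {φ : M → ℂ} (hφ : ContMDiff I 𝓘(ℝ, ℂ) ∞ φ) (p : M) :
    tension g φ p =
      localTension b (coordForm g p) (φ ∘ (extChartAt I p).symm) (extChartAt I p p) :=
  (isMetricAt_coordForm g p).localTension_change b (Module.finBasis ℝ E)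
    (differentiableAt_fderiv_apply_of_contDiffAt (contDiffAt_comp_extChartAt_symm hφ p))

lemma conformality_eq_localConformality [FiniteDimensional ℝ E] [BoundarylessManifold I M]
    {ι : Type*} [Fintype ι] [DecidableEq ι] (b : Module.Basis ι ℝ E)
    (g : SmoothMetric I M) (φ ψ : M → ℂ) (p : M) :
    conformality g φ ψ p = localConformality b (coordForm g p (extChartAt I p p))
      (φ ∘ (extChartAt I p).symm) (ψ ∘ (extChartAt I p).symm) (extChartAt I p p) :=
  localConformality_change b (Module.finBasis ℝ E) ((isMetricAt_coordForm g p).det_pos b).ne' _ _ _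

end Coordinates

section Product

variable {E₁ : Type*} [NormedAddCommGroup E₁] [NormedSpace ℝ E₁]
  {H₁ : Type*} [TopologicalSpace H₁] {I₁ : ModelWithCorners ℝ E₁ H₁}
  {M₁ : Type*} [TopologicalSpace M₁] [ChartedSpace H₁ M₁] [IsManifold I₁ ∞ M₁]
  {E₂ : Type*} [NormedAddCommGroup E₂] [NormedSpace ℝ E₂]
  {H₂ : Type*} [TopologicalSpace H₂] {I₂ : ModelWithCorners ℝ E₂ H₂}
  {M₂ : Type*} [TopologicalSpace M₂] [ChartedSpace H₂ M₂] [IsManifold I₂ ∞ M₂]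

omit [IsManifold I₁ ∞ M₁] [IsManifold I₂ ∞ M₂] in
lemma extChartAt_prod_symm_eq (p : M₁ × M₂) :
    ((extChartAt (I₁.prod I₂) p).symm : E₁ × E₂ → M₁ × M₂) =
      Prod.map (extChartAt I₁ p.1).symm (extChartAt I₂ p.2).symm := by
  rw [extChartAt_prod]
  rfl

lemma isOrthogonalSum_coordForm (g₁ : SmoothMetric I₁ M₁) (g₂ : SmoothMetric I₂ M₂)
    (p : M₁ × M₂) {y : E₁ × E₂}
    (h₁ : MDifferentiableAt 𝓘(ℝ, E₁) I₁ (extChartAt I₁ p.1).symm y.1)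
    (h₂ : MDifferentiableAt 𝓘(ℝ, E₂) I₂ (extChartAt I₂ p.2).symm y.2) :
    IsOrthogonalSum (coordForm (prodMetric g₁ g₂) p y) (coordForm g₁ p.1 y.1)
      (coordForm g₂ p.2 y.2) := by
  intro v w
  unfold coordForm
  rw [extChartAt_prod_symm_eq]
  refine (pullback_apply (I' := 𝓘(ℝ, E₁ × E₂)) _ _ _ _ _).trans ?_
  rw [prodMetric_inner]
  have h := mfderiv_prodMap (p := y) h₁ h₂
  rw [← modelWithCornersSelf_prod, chartedSpaceSelf_prod] at h
  rw [h]
  rfl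

lemma eventually_isOrthogonalSum_coordForm [BoundarylessManifold I₁ M₁]
    [BoundarylessManifold I₂ M₂] (g₁ : SmoothMetric I₁ M₁) (g₂ : SmoothMetric I₂ M₂)
    (p : M₁ × M₂) :
    ∀ᶠ y in 𝓝 (extChartAt (I₁.prod I₂) p p), IsOrthogonalSum (coordForm (prodMetric g₁ g₂) p y)
      (coordForm g₁ p.1 y.1) (coordForm g₂ p.2 y.2) := by
  have h₁ := eventually_mem_nhds_iff.2
    (extChartAt_target_mem_nhds_of_boundaryless (I := I₁) p.1)
  have h₂ := eventually_mem_nhds_iff.2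
    (extChartAt_target_mem_nhds_of_boundaryless (I := I₂) p.2)
  rw [extChartAt_prod]
  change ∀ᶠ y in 𝓝 (extChartAt I₁ p.1 p.1, extChartAt I₂ p.2 p.2), _
  filter_upwards [continuousAt_fst.eventually h₁, continuousAt_snd.eventually h₂] with y hy₁ hy₂
  exact isOrthogonalSum_coordForm g₁ g₂ p
    ((contMDiffAt_extChartAt_symm_of_mem_nhds hy₁).mdifferentiableAt (by simp))
    ((contMDiffAt_extChartAt_symm_of_mem_nhds hy₂).mdifferentiableAt (by simp))

omit [IsManifold I₁ ∞ M₁] [IsManifold I₂ ∞ M₂] in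
lemma contMDiff_mul_prod {φ₁ : M₁ → ℂ} {φ₂ : M₂ → ℂ} (h₁ : ContMDiff I₁ 𝓘(ℝ, ℂ) ∞ φ₁)
    (h₂ : ContMDiff I₂ 𝓘(ℝ, ℂ) ∞ φ₂) :
    ContMDiff (I₁.prod I₂) 𝓘(ℝ, ℂ) ∞ (fun p : M₁ × M₂ ↦ φ₁ p.1 * φ₂ p.2) := by
  have hm : ContDiff ℝ ∞ (fun z : ℂ × ℂ ↦ z.1 * z.2) := contDiff_fst.mul contDiff_snd
  exact hm.contMDiff.comp ((h₁.comp contMDiff_fst).prodMk_space (h₂.comp contMDiff_snd))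

omit [IsManifold I₁ ∞ M₁] [IsManifold I₂ ∞ M₂] in
lemma mul_prod_comp_extChartAt_symm (φ₁ : M₁ → ℂ) (φ₂ : M₂ → ℂ) (p : M₁ × M₂) :
    (fun q : M₁ × M₂ ↦ φ₁ q.1 * φ₂ q.2) ∘ (extChartAt (I₁.prod I₂) p).symm =
      fun y : E₁ × E₂ ↦ (φ₁ ∘ (extChartAt I₁ p.1).symm) y.1 *
        (φ₂ ∘ (extChartAt I₂ p.2).symm) y.2 := by
  rw [extChartAt_prod_symm_eq]
  rfl

variable [FiniteDimensional ℝ E₁] [FiniteDimensional ℝ E₂]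
  [BoundarylessManifold I₁ M₁] [BoundarylessManifold I₂ M₂]

/-- The product rule for the tension field of a Riemannian product. -/
theorem tension_mul_prod (g₁ : SmoothMetric I₁ M₁) (g₂ : SmoothMetric I₂ M₂)
    {φ₁ : M₁ → ℂ} {φ₂ : M₂ → ℂ} (h₁ : ContMDiff I₁ 𝓘(ℝ, ℂ) ∞ φ₁)
    (h₂ : ContMDiff I₂ 𝓘(ℝ, ℂ) ∞ φ₂) (p : M₁ × M₂) :
    tension (prodMetric g₁ g₂) (fun q ↦ φ₁ q.1 * φ₂ q.2) p =
      tension g₁ φ₁ p.1 * φ₂ p.2 + φ₁ p.1 * tension g₂ φ₂ p.2 := by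
  have hx : extChartAt (I₁.prod I₂) p p = (extChartAt I₁ p.1 p.1, extChartAt I₂ p.2 p.2) := by
    rw [extChartAt_prod]; rfl
  have ho := eventually_isOrthogonalSum_coordForm g₁ g₂ p
  rw [tension_eq_localTension (Module.finBasis ℝ E₁) g₁ h₁,
    tension_eq_localTension (Module.finBasis ℝ E₂) g₂ h₂,
    tension_eq_localTension ((Module.finBasis ℝ E₁).prod (Module.finBasis ℝ E₂)) _
      (contMDiff_mul_prod h₁ h₂), mul_prod_comp_extChartAt_symm]
  rw [hx] at ho ⊢
  refine (localTension_mul_prod _ _ (isMetricAt_coordForm g₁ p.1) (isMetricAt_coordForm g₂ p.2) ho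
    (contDiffAt_comp_extChartAt_symm h₁ p.1) (contDiffAt_comp_extChartAt_symm h₂ p.2)).trans ?_
  simp

/-- The product rule for the conformality operator of a Riemannian product. -/
theorem conformality_mul_prod (g₁ : SmoothMetric I₁ M₁) (g₂ : SmoothMetric I₂ M₂)
    {φ₁ ψ₁ : M₁ → ℂ} {φ₂ ψ₂ : M₂ → ℂ} (h₁ : ContMDiff I₁ 𝓘(ℝ, ℂ) ∞ φ₁)
    (h₂ : ContMDiff I₂ 𝓘(ℝ, ℂ) ∞ φ₂) (k₁ : ContMDiff I₁ 𝓘(ℝ, ℂ) ∞ ψ₁)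
    (k₂ : ContMDiff I₂ 𝓘(ℝ, ℂ) ∞ ψ₂) (p : M₁ × M₂) :
    conformality (prodMetric g₁ g₂) (fun q ↦ φ₁ q.1 * φ₂ q.2) (fun q ↦ ψ₁ q.1 * ψ₂ q.2) p =
      conformality g₁ φ₁ ψ₁ p.1 * (φ₂ p.2 * ψ₂ p.2) +
      (φ₁ p.1 * ψ₁ p.1) * conformality g₂ φ₂ ψ₂ p.2 := by
  have hx : extChartAt (I₁.prod I₂) p p = (extChartAt I₁ p.1 p.1, extChartAt I₂ p.2 p.2) := by
    rw [extChartAt_prod]; rfl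
  have ho := (eventually_isOrthogonalSum_coordForm g₁ g₂ p).self_of_nhds
  rw [conformality_eq_localConformality (Module.finBasis ℝ E₁) g₁,
    conformality_eq_localConformality (Module.finBasis ℝ E₂) g₂,
    conformality_eq_localConformality ((Module.finBasis ℝ E₁).prod (Module.finBasis ℝ E₂)),
    mul_prod_comp_extChartAt_symm, mul_prod_comp_extChartAt_symm]
  rw [hx] at ho ⊢
  have d₁ {χ : M₁ → ℂ} (h : ContMDiff I₁ 𝓘(ℝ, ℂ) ∞ χ) :=
    (contDiffAt_comp_extChartAt_symm h p.1).differentiableAt (by simp)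
  have d₂ {χ : M₂ → ℂ} (h : ContMDiff I₂ 𝓘(ℝ, ℂ) ∞ χ) :=
    (contDiffAt_comp_extChartAt_symm h p.2).differentiableAt (by simp)
  refine (localConformality_mul_prod _ _ ho ((isMetricAt_coordForm g₁ p.1).det_pos _).ne'
    ((isMetricAt_coordForm g₂ p.2).det_pos _).ne' (d₁ h₁) (d₂ h₂) (d₁ k₁) (d₂ k₂)).trans ?_
  simp

end Product

end EigenFamily

end

theorem mainTheorem4
    {E₁ : Type*} [NormedAddCommGroup E₁] [NormedSpace ℝ E₁] [FiniteDimensional ℝ E₁]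
    {H₁ : Type*} [TopologicalSpace H₁] {I₁ : ModelWithCorners ℝ E₁ H₁}
    {M₁ : Type*} [TopologicalSpace M₁] [ChartedSpace H₁ M₁] [IsManifold I₁ ∞ M₁]
    [BoundarylessManifold I₁ M₁]
    {E₂ : Type*} [NormedAddCommGroup E₂] [NormedSpace ℝ E₂] [FiniteDimensional ℝ E₂]
    {H₂ : Type*} [TopologicalSpace H₂] {I₂ : ModelWithCorners ℝ E₂ H₂}
    {M₂ : Type*} [TopologicalSpace M₂] [ChartedSpace H₂ M₂] [IsManifold I₂ ∞ M₂]
    [BoundarylessManifold I₂ M₂]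
    (g₁ : EigenFamily.SmoothMetric I₁ M₁) (g₂ : EigenFamily.SmoothMetric I₂ M₂)
    (lam₁ mu₁ lam₂ mu₂ : ℂ) (𝓔₁ : Set (M₁ → ℂ)) (𝓔₂ : Set (M₂ → ℂ))
    (h₁ : EigenFamily.IsEigenfamily g₁ lam₁ mu₁ 𝓔₁)
    (h₂ : EigenFamily.IsEigenfamily g₂ lam₂ mu₂ 𝓔₂) :
    EigenFamily.IsEigenfamily (EigenFamily.prodMetric g₁ g₂) (lam₁ + lam₂) (mu₁ + mu₂)
      {φ : M₁ × M₂ → ℂ | ∃ φ₁ ∈ 𝓔₁, ∃ φ₂ ∈ 𝓔₂, φ = fun p ↦ φ₁ p.1 * φ₂ p.2} := by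
  refine ⟨?_, ?_, ?_⟩
  · rintro _ ⟨φ₁, hφ₁, φ₂, hφ₂, rfl⟩
    exact EigenFamily.contMDiff_mul_prod (h₁.smooth _ hφ₁) (h₂.smooth _ hφ₂)
  · rintro _ ⟨φ₁, hφ₁, φ₂, hφ₂, rfl⟩ p
    rw [EigenFamily.tension_mul_prod g₁ g₂ (h₁.smooth _ hφ₁) (h₂.smooth _ hφ₂),
      h₁.tension_eq _ hφ₁, h₂.tension_eq _ hφ₂]
    ring
  · rintro _ ⟨φ₁, hφ₁, φ₂, hφ₂, rfl⟩ _ ⟨ψ₁, hψ₁, ψ₂, hψ₂, rfl⟩ p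
    rw [EigenFamily.conformality_mul_prod g₁ g₂ (h₁.smooth _ hφ₁) (h₂.smooth _ hφ₂)
      (h₁.smooth _ hψ₁) (h₂.smooth _ hψ₂), h₁.conformality_eq _ hφ₁ _ hψ₁,
      h₂.conformality_eq _ hφ₂ _ hψ₂]
    ring
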